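/- Let $K$ be a field and let $m_1,\dots,m_n$ ($n\ge 1$) be positive integers that form the minimal generating system of the additive semigroup $S=\langle m_1,\dots,m_n\rangle\subseteq\mathbb N$, with $m_1=\min_i m_i$, so that the monomial curve $C=\{(t^{m_1},\dots,t^{m_n})\}$ has multiplicity $m_1$. For a positive integer $k$ with $\gcd(k,m_1)=1$, the $k$-lifting $C_k$ of $C$ is the monomial curve given by the semigroup $S_k=\langle m_1,km_2,\dots,km_n\rangle$. A monomial curve with semigroup $T=\langle a_1,\dots,a_n\rangle$ is said to have a Cohen–Macaulay tangent cone if the associated graded ring $\operatorname{gr}_{\mathfrak m}(K[T])=\bigoplus_{i\ge 0}\mathfrak m^i/\mathfrak m^{i+1}$ is Cohen–Macaulay, where $K[T]=K[t^{a_1},\dots,t^{a_n}]\subseteq K[t]$ and $\mathfrak m=\langle t^{a_1},\dots,t^{a_n}\rangle$. 1. If $C$ has a Cohen–Macaulay tangent cone, then $C_k$ has a Cohen–Macaulay tangent cone for every $k\geq 1$ with $\gcd(k,m_1)=1$. 2. If $C$ does not have a Cohen–Macaulay tangent cone, then there is a positive integer $k_0$ such that $C_k$ has a Cohen–Macaulay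 tangent cone for every $k\ge k_0$ with $\gcd(k,m_1)=1$. -/

import Mathlib

/-! ### Cohen-Macaulay rings -/

/-- The depth of a local ring: the supremum of the lengths of the regular sequences
contained in its maximal ideal. -/
noncomputable def localDepth (A : Type*) [CommRing A] [IsLocalRing A] : ℕ∞ :=
  sSup {d : ℕ∞ | ∃ rs : List A, (∀ r ∈ rs, r ∈ IsLocalRing.maximalIdeal A) ∧
    RingTheory.Sequence.IsRegular A rs ∧ d = (rs.length : ℕ∞)}

/-- A local ring is Cohen-Macaulay if it is Noetherian and its depth equals its Krull dimension. -/
def IsCohenMacaulayLocal (A : Type*) [CommRing A] [IsLocalRing A] : Prop :=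
  IsNoetherianRing A ∧ ((localDepth A : ℕ∞) : WithBot ℕ∞) = ringKrullDim A

/-- A commutative ring is Cohen-Macaulay if it is Noetherian and its localization at every
maximal ideal is a Cohen-Macaulay local ring. -/
def IsCohenMacaulay (A : Type*) [CommRing A] : Prop :=
  IsNoetherianRing A ∧
    ∀ (p : Ideal A) [p.IsMaximal], IsCohenMacaulayLocal (Localization.AtPrime p)

/-! ### The associated graded ring of an ideal -/

/-- In the Rees algebra `⨁ Iⁱ Xⁱ` of `I`, the ideal `⨁ Iⁱ⁺¹ Xⁱ` of the polynomials whose `i`-th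
coefficient lies in `I ^ (i + 1)`. -/
def assocGradedIdeal {A : Type*} [CommRing A] (I : Ideal A) : Ideal (reesAlgebra I) where
  carrier := {f | ∀ i, (f : Polynomial A).coeff i ∈ I ^ (i + 1)}
  zero_mem' := fun i => by simp
  add_mem' := fun {f g} hf hg i => by
    simpa using (I ^ (i + 1)).add_mem (hf i) (hg i)
  smul_mem' := fun c f hf i => by
    simp only [smul_eq_mul, MulMemClass.coe_mul, Polynomial.coeff_mul]
    refine Ideal.sum_mem _ ?_
    rintro ⟨a, b⟩ hab
    rw [← Finset.HasAntidiagonal.mem_antidiagonal.mp hab, add_assoc, pow_add]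
    exact Ideal.mul_mem_mul (c.2 a) (hf b)

/-- The associated graded ring `gr_I(A) = ⨁ Iⁱ / Iⁱ⁺¹`. -/
abbrev AssocGradedRing {A : Type*} [CommRing A] (I : Ideal A) : Type _ :=
  reesAlgebra I ⧸ assocGradedIdeal I

/-! ### Monomial curves, their tangent cones and their liftings -/

/-- `m₁, …, mₙ` are positive and form a minimal generating system of the semigroup they generate:
none of them is a sum of copies of the others. -/
def IsMinimalGenerators {ι : Type*} (m : ι → ℕ) : Prop :=
  (∀ i, 0 < m i) ∧ ∀ i, m i ∉ AddSubmonoid.closure (m '' {i}ᶜ)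

/-- The semigroup ring `K[S]` of the semigroup `S` generated by the `m i`: the `K`-subalgebra of
`K[t]` generated by the monomials `t ^ m i`. -/
noncomputable abbrev semigroupRing (K : Type*) [Field K] {ι : Type*} (m : ι → ℕ) :
    Subalgebra K (Polynomial K) :=
  Algebra.adjoin K (Set.range fun i => (Polynomial.X : Polynomial K) ^ m i)

/-- The ideal of `K[S]` generated by the monomials `t ^ m i`; for positive `m i` it is the maximal
ideal at the origin of the monomial curve. -/
noncomputable def originIdeal (K : Type*) [Field K] {ι : Type*} (m : ι → ℕ) :
    Ideal (semigroupRing K m) :=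
  Ideal.span (Set.range fun i =>
    (⟨Polynomial.X ^ m i, Algebra.subset_adjoin ⟨i, rfl⟩⟩ : semigroupRing K m))

/-- The tangent cone at the origin of the monomial curve `t ↦ (t ^ m₁, …, t ^ mₙ)`, that is its
coordinate ring `gr_𝔪(K[S])`, is Cohen-Macaulay. -/
def HasCohenMacaulayTangentCone (K : Type*) [Field K] {ι : Type*} (m : ι → ℕ) : Prop :=
  IsCohenMacaulay (AssocGradedRing (originIdeal K m))

/-- The generators `m₁, k m₂, …, k mₙ` of the `k`-lifting (`m₁` is `m 0`). -/
def liftGenerators {n : ℕ} (k : ℕ) (m : Fin (n + 1) → ℕ) : Fin (n + 1) → ℕ :=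
  Fin.cons (m 0) fun i : Fin n => k * m i.succ

/-! ### Depth at least one and the Cohen-Macaulay property -/

/-! Let `I` be the ideal of the origin, spanned by the monomials `t ^ m i`. If `m i > m 0`, the
initial form of `t ^ m i` is nilpotent, because `(t ^ m i) ^ m 0 = (t ^ m 0) ^ m i`. So the tangent
cone is, modulo nilpotents, a polynomial ring in the initial form of `t ^ m 0`. It has dimension one
and is Cohen-Macaulay iff that initial form is a nonzerodivisor
(`isCohenMacaulay_assocGradedRing_iff`). Since `I ^ j` is spanned by the `t ^ s` whose exponent `s`
has a factorization of length at least `j` (`mem_originIdeal_pow`), this becomes the combinatorial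
condition `IsHeadAdditive`.

For the lifting, only factorizations of `s + m 0` avoiding `m 0` matter. Coprimality lets such a
relation be divided by `k`, giving `∑ d i * m i = u + m 0` in the original semigroup. Conversely,
any factorization `c` of `u` yields one of `s + m 0` with `k * (c 0 + 1)` copies of `m 0`. It
remains to find `c` for which this is at least as long as `d`. Head additivity of `m` provides it
for every `k`; in general Dickson's lemma leaves finitely many minimal `d`, and a large `k`
outweighs their lengths. -/

lemma localDepth_le_ringKrullDim (A : Type*) [CommRing A] [IsLocalRing A] [IsNoetherianRing A] :
    ((localDepth A : ℕ∞) : WithBot ℕ∞) ≤ ringKrullDim A := by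
  obtain ⟨d, hd⟩ := WithBot.ne_bot_iff_exists.mp
    (ne_of_gt (lt_of_lt_of_le (WithBot.bot_lt_coe _)
      (ringKrullDim_nonneg_of_nontrivial (R := A))))
  rw [← hd, WithBot.coe_le_coe]
  refine sSup_le ?_
  rintro _ ⟨rs, -, hreg, rfl⟩
  have h := ringKrullDim_add_length_eq_ringKrullDim_of_isRegular rs hreg
  have hne : Nontrivial (A ⧸ Ideal.ofList rs) := by
    rw [Ideal.Quotient.nontrivial_iff]
    intro h'
    exact hreg.top_ne_smul (by simp [h'])
  have h0 : 0 ≤ ringKrullDim (A ⧸ Ideal.ofList rs) := ringKrullDim_nonneg_of_nontrivial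
  have : ((rs.length : ℕ∞) : WithBot ℕ∞) ≤ ringKrullDim A := by
    rw [← h]
    exact le_add_of_nonneg_left h0
  rw [← hd] at this
  exact WithBot.coe_le_coe.mp this

lemma isCohenMacaulayLocal_of_isSMulRegular {A : Type*} [CommRing A] [IsLocalRing A]
    [IsNoetherianRing A] (hdim : ringKrullDim A ≤ 1) {r : A}
    (hr : r ∈ IsLocalRing.maximalIdeal A) (hreg : IsSMulRegular A r) :
    IsCohenMacaulayLocal A := by
  refine ⟨inferInstance, le_antisymm (localDepth_le_ringKrullDim A) (hdim.trans ?_)⟩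
  have hmem : ∀ s ∈ [r], s ∈ IsLocalRing.maximalIdeal A := by simpa using hr
  have h : (1 : ℕ∞) ≤ localDepth A :=
    le_sSup ⟨[r], hmem, RingTheory.Sequence.IsRegular.of_isWeaklyRegular_of_mem_maximalIdeal A hmem
      ((RingTheory.Sequence.isWeaklyRegular_singleton_iff A r).mpr hreg), by simp⟩
  exact_mod_cast h

lemma exists_isSMulRegular_of_isCohenMacaulayLocal {A : Type*} [CommRing A] [IsLocalRing A]
    (hA : IsCohenMacaulayLocal A) (hdim : ringKrullDim A ≠ 0) :
    ∃ r ∈ IsLocalRing.maximalIdeal A, IsSMulRegular A r := by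
  by_contra! h
  apply hdim
  rw [← hA.2]
  have : localDepth A = 0 := by
    refine nonpos_iff_eq_zero.mp (sSup_le ?_)
    rintro _ ⟨rs, hmem, hreg, rfl⟩
    cases rs with
    | nil => simp
    | cons r rs =>
      exact absurd ((RingTheory.Sequence.isRegular_cons_iff A r rs).mp hreg).1
        (h r (hmem r (by simp)))
  rw [this]; rfl

/-! ### Algebras that are a polynomial ring modulo nilpotents -/

open Polynomial in
-- Primes contain all nilpotents, so `Spec G` embeds in `Spec K[X]` and the dimension is at most
-- one. Each maximal ideal contains some `φ f` with `f ≠ 0`, and its regularity survives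
-- localization.
lemma isCohenMacaulay_of_isSMulRegular_aeval {K G : Type*} [Field K] [CommRing G] [Algebra K G]
    [IsNoetherianRing G] (φ : K[X] →ₐ[K] G) (hφ : ∀ g, ∃ f, IsNilpotent (g - φ f))
    (hreg : ∀ f, f ≠ 0 → IsSMulRegular G (φ f)) : IsCohenMacaulay G := by
  have hmem : ∀ (p : Ideal G) [p.IsPrime] (g : G), ∃ f, g - φ f ∈ p := fun p hp g ↦
    let ⟨f, hf⟩ := hφ g
    ⟨f, nilradical_le_prime p hf⟩
  have hdim : ringKrullDim G ≤ 1 := by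
    have h1 : ringKrullDim K[X] ≤ 1 := by
      have := IsPrincipalIdealRing.krullDimLE_one K[X]
      exact_mod_cast Ring.krullDimLE_iff.mp this
    refine le_trans ?_ h1
    refine Order.krullDim_le_of_strictMono (PrimeSpectrum.comap (φ : K[X] →+* G)) ?_
    refine Monotone.strictMono_of_injective (fun p q h ↦ Ideal.comap_mono h) ?_
    have key : ∀ p q : PrimeSpectrum G, PrimeSpectrum.comap (φ : K[X] →+* G) p =
        PrimeSpectrum.comap (φ : K[X] →+* G) q → p.asIdeal ≤ q.asIdeal := by
      intro p q h g hg
      obtain ⟨f, hf⟩ := hφ g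
      have h2 : f ∈ (PrimeSpectrum.comap (φ : K[X] →+* G) p).asIdeal := by
        change φ f ∈ p.asIdeal
        simpa using p.asIdeal.sub_mem hg (nilradical_le_prime p.asIdeal hf)
      rw [h] at h2
      have h3 : φ f ∈ q.asIdeal := h2
      simpa using q.asIdeal.add_mem h3 (nilradical_le_prime q.asIdeal hf)
    exact fun p q h ↦ PrimeSpectrum.ext (le_antisymm (key p q h) (key q p h.symm))
  refine ⟨inferInstance, fun p hp ↦ ?_⟩
  obtain ⟨f, hf0, hfp⟩ : ∃ f, f ≠ 0 ∧ φ f ∈ p := by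
    by_contra! h
    -- Otherwise `K[X]` would map isomorphically onto the field `G ⧸ p`.
    refine Polynomial.not_isField K ⟨⟨0, 1, zero_ne_one⟩, mul_comm, fun {a} ha ↦ ?_⟩
    obtain ⟨y, i, hi, hy⟩ := hp.exists_inv (h a ha)
    obtain ⟨b, hb⟩ := hmem p y
    refine ⟨b, ?_⟩
    by_contra hab
    refine h (a * b - 1) (sub_ne_zero.mpr hab) ?_
    have : φ (a * b - 1) = -(φ a * (y - φ b)) + (y * φ a + i - 1) - i := by
      simp only [map_sub, map_mul, map_one]; ring
    rw [this, hy, sub_self, add_zero]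
    exact p.sub_mem (p.neg_mem (p.mul_mem_left _ hb)) hi
  refine isCohenMacaulayLocal_of_isSMulRegular (r := algebraMap G _ (φ f)) ?_ ?_ ?_
  · rw [IsLocalization.AtPrime.ringKrullDim_eq_height p]
    exact Ideal.height_le_ringKrullDim_of_isPrime.trans hdim
  · rwa [IsLocalization.AtPrime.to_map_mem_maximal_iff _ p]
  · exact (hreg f hf0).of_isLocalizedModule (Localization.AtPrime p) p.primeCompl (Algebra.linearMap G _)

open Polynomial in
-- A maximal ideal `M` containing `φ X` consists of multiples of `φ X` plus nilpotents. Positive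
-- dimension at `M` yields a regular element of this form; on the annihilator of `φ X` it acts
-- nilpotently, so that annihilator dies in the localization. Elements outside `M` act on it as
-- units, so it is zero.
lemma isSMulRegular_of_isCohenMacaulay {K G : Type*} [Field K] [CommRing G] [Algebra K G]
    (φ : K[X] →ₐ[K] G) (hφ : ∀ g, ∃ f, IsNilpotent (g - φ f))
    (hinj : ∀ f, IsNilpotent (φ f) → f = 0) (hG : IsCohenMacaulay G) :
    IsSMulRegular G (φ X) := by
  have hX : ¬ IsUnit (φ X) := by
    intro h
    obtain ⟨g, hg⟩ := h.exists_right_inv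
    obtain ⟨f, hf⟩ := hφ g
    have h1 : φ (1 - X * f) = φ X * (g - φ f) := by
      simp only [map_sub, map_mul, map_one, mul_sub, hg]
    have h2 := hinj (1 - X * f) (h1 ▸ (Commute.all _ _).isNilpotent_mul_left hf)
    have := congrArg (Polynomial.eval 0) h2
    simp at this
  obtain ⟨M, hM, hXM⟩ := exists_max_ideal_of_mem_nonunits hX
  have hsplit : ∀ g, ∃ c : K, ∃ f ν, IsNilpotent ν ∧ g = algebraMap K G c + φ X * φ f + ν := by
    intro g
    obtain ⟨f, hf⟩ := hφ g
    refine ⟨f.coeff 0, f.divX, _, hf, ?_⟩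
    conv_lhs => rw [← add_sub_cancel (φ f) g]
    congr 1
    conv_lhs => rw [← X_mul_divX_add f]
    rw [map_add, map_mul, add_comm, ← algebraMap_eq, AlgHom.commutes]
  have hmax : ∀ g, g ∈ M → ∃ f ν, IsNilpotent ν ∧ g = φ X * φ f + ν := by
    intro g hg
    obtain ⟨c, f, ν, hν, rfl⟩ := hsplit g
    refine ⟨f, ν, hν, ?_⟩
    have hc : algebraMap K G c ∈ M := by
      have h2 := nilradical_le_prime M hν
      have h3 := M.mul_mem_right (φ f) hXM
      rw [add_assoc] at hg
      exact (M.add_mem_iff_left (M.add_mem h3 h2)).mp hg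
    have : c = 0 := by
      by_contra hc0
      exact hM.ne_top (Ideal.eq_top_of_isUnit_mem _ hc ((IsUnit.mk0 c hc0).map (algebraMap K G)))
    simp [this]
  have hcompl : ∀ g, g ∉ M → ∃ c : K, c ≠ 0 ∧ ∃ f ν, IsNilpotent ν ∧
      g = algebraMap K G c + φ X * φ f + ν := by
    intro g hg
    obtain ⟨c, f, ν, hν, rfl⟩ := hsplit g
    refine ⟨c, ?_, f, ν, hν, rfl⟩
    rintro rfl
    refine hg ?_
    rw [map_zero, zero_add]
    exact M.add_mem (M.mul_mem_right _ hXM) (nilradical_le_prime M hν)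
  -- In dimension zero `φ X` would be nilpotent at `M`, so some nonzero `(C a + X * f) * X ^ N`
  -- would have nilpotent image.
  have hdim : ringKrullDim (Localization.AtPrime M) ≠ 0 := by
    intro h0
    have h1 : Ring.KrullDimLE 0 (Localization.AtPrime M) := by
      rw [Ring.krullDimLE_iff, h0]; simp
    have h2 := ((Ring.krullDimLE_zero_and_isLocalRing_tfae (Localization.AtPrime M)).out 0 2
      rfl rfl).mp ⟨h1, inferInstance⟩
    obtain ⟨N, hN⟩ := (h2 (algebraMap G _ (φ X))).mpr
      (by rwa [← mem_nonunits_iff, ← IsLocalRing.mem_maximalIdeal,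
        IsLocalization.AtPrime.to_map_mem_maximal_iff _ M])
    rw [← map_pow, IsLocalization.map_eq_zero_iff M.primeCompl] at hN
    obtain ⟨⟨c, hc⟩, hcN⟩ := hN
    obtain ⟨a, ha, f, ν, hν, rfl⟩ := hcompl c hc
    have h3 : φ ((C a + X * f) * X ^ N) = - (φ X ^ N * ν) := by
      simp only [map_mul, map_add, map_pow, ← algebraMap_eq, AlgHom.commutes]
      simp only at hcN
      linear_combination hcN
    have h4 := hinj _ (h3 ▸ ((Commute.all _ _).isNilpotent_mul_left hν).neg)
    have h5 := (mul_eq_zero.mp h4).resolve_right (pow_ne_zero _ X_ne_zero)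
    have := congrArg (Polynomial.eval 0) h5
    simp [ha] at this
  obtain ⟨r, hr, hreg⟩ := exists_isSMulRegular_of_isCohenMacaulayLocal (hG.2 M) hdim
  obtain ⟨a, s, rfl⟩ := IsLocalization.exists_mk'_eq M.primeCompl r
  rw [IsLocalization.AtPrime.mk'_mem_maximal_iff _ M] at hr
  obtain ⟨f, ν, ⟨N, hN⟩, rfl⟩ := hmax a hr
  refine isSMulRegular_iff_right_eq_zero_of_smul.mpr fun z hz ↦ ?_
  rw [smul_eq_mul] at hz
  have hz1 : ∀ n, (φ X * φ f + ν) ^ n * z = ν ^ n * z := by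
    intro n
    induction n with
    | zero => simp
    | succ n ih => rw [pow_succ, pow_succ]; linear_combination ν * ih +
                    (φ X * φ f + ν) ^ n * φ f * hz
  have hz2 : algebraMap G (Localization.AtPrime M) z = 0 := by
    refine isSMulRegular_iff_right_eq_zero_of_smul.mp (hreg.pow N) _ ?_
    rw [smul_eq_mul, ← IsLocalization.mk'_pow, ← IsLocalization.mk'_one (M := M.primeCompl),
      ← IsLocalization.mk'_mul, hz1, hN, zero_mul, IsLocalization.mk'_zero]
  rw [IsLocalization.map_eq_zero_iff M.primeCompl] at hz2
  obtain ⟨⟨c, hc⟩, hcz⟩ := hz2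
  obtain ⟨a, ha, g, μ, hμ, rfl⟩ := hcompl c hc
  have hu : IsUnit (algebraMap K G a + μ) :=
    IsNilpotent.isUnit_add_left_of_commute hμ ((IsUnit.mk0 a ha).map _) (Commute.all _ _)
  refine (hu.mul_right_eq_zero).mp ?_
  simp only at hcz
  linear_combination hcz - φ g * hz

/-! ### Lengths of factorizations in the semigroup -/

/-- `s` is a sum of at least `l` of the generators `m i`, counted with multiplicity. -/
def HasFactorization {ι : Type*} [Fintype ι] (m : ι → ℕ) (l s : ℕ) : Prop :=
  ∃ c : ι → ℕ, ∑ i, c i * m i = s ∧ l ≤ ∑ i, c i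

namespace HasFactorization

variable {ι : Type*} [Fintype ι] {m : ι → ℕ} {l l' s s' : ℕ}

lemma mono (h : HasFactorization m l s) (hl : l' ≤ l) : HasFactorization m l' s :=
  let ⟨c, hc, hlc⟩ := h
  ⟨c, hc, hl.trans hlc⟩

lemma add (h : HasFactorization m l s) (h' : HasFactorization m l' s') :
    HasFactorization m (l + l') (s + s') := by
  obtain ⟨c, rfl, hl⟩ := h
  obtain ⟨d, rfl, hl'⟩ := h'
  refine ⟨c + d, ?_, ?_⟩
  · simp [add_mul, Finset.sum_add_distrib]
  · simpa [Finset.sum_add_distrib] using add_le_add hl hl'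

variable (m) in
lemma zero : HasFactorization m 0 0 := ⟨0, by simp, by simp⟩

variable (m) in
lemma single (i : ι) : HasFactorization m 1 (m i) := by
  classical
  exact ⟨Pi.single i 1, by simp [Pi.single_apply], by simp [Pi.single_apply]⟩

lemma mul_le {a : ℕ} (ha : ∀ i, a ≤ m i) (h : HasFactorization m l s) : l * a ≤ s := by
  obtain ⟨c, rfl, hl⟩ := h
  calc l * a ≤ (∑ i, c i) * a := Nat.mul_le_mul_right a hl
    _ = ∑ i, c i * a := Finset.sum_mul ..
    _ ≤ _ := Finset.sum_le_sum fun i _ ↦ Nat.mul_le_mul_left _ (ha i)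

end HasFactorization

/-- Adding `m 0` to an element of the semigroup raises its maximal factorization length by
exactly one. -/
def IsHeadAdditive {n : ℕ} (m : Fin (n + 1) → ℕ) : Prop :=
  ∀ l s, HasFactorization m 0 s → HasFactorization m (l + 1) (s + m 0) → HasFactorization m l s

/-- This one-degree form matches the nonzerodivisor condition on `I ^ j / I ^ (j + 1)`. -/
lemma isHeadAdditive_iff {n : ℕ} (m : Fin (n + 1) → ℕ) : IsHeadAdditive m ↔
    ∀ l s, HasFactorization m l s → HasFactorization m (l + 2) (s + m 0) →
      HasFactorization m (l + 1) s := by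
  refine ⟨fun h l s hs hs' ↦ h _ _ (hs.mono l.zero_le) hs', fun h l s hs hs' ↦ ?_⟩
  induction l with
  | zero => exact hs
  | succ l ih => exact h l s (ih (hs'.mono (by omega))) hs'

lemma hasFactorization_of_head_pos {n : ℕ} {m c : Fin (n + 1) → ℕ} {l s : ℕ} (h0 : c 0 ≠ 0)
    (hc : ∑ i, c i * m i = s + m 0) (hl : l + 1 ≤ ∑ i, c i) : HasFactorization m l s := by
  obtain ⟨a, ha⟩ := Nat.exists_eq_succ_of_ne_zero h0
  rw [Fin.sum_univ_succ, ha] at hc hl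
  refine ⟨Fin.cons a fun i ↦ c i.succ, ?_, ?_⟩
  · simp only [Fin.sum_univ_succ, Fin.cons_zero, Fin.cons_succ]
    rw [Nat.succ_mul] at hc
    omega
  · simp only [Fin.sum_univ_succ, Fin.cons_zero, Fin.cons_succ]
    omega

lemma sum_mul_liftGenerators {n : ℕ} (k : ℕ) (m c : Fin (n + 1) → ℕ) :
    ∑ i, c i * liftGenerators k m i = c 0 * m 0 + k * ∑ i : Fin n, c i.succ * m i.succ := by
  rw [Fin.sum_univ_succ, Finset.mul_sum]
  simp only [liftGenerators, Fin.cons_zero, Fin.cons_succ]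
  congr 1
  exact Finset.sum_congr rfl fun i _ ↦ by ring

/-- Reduction of head additivity of a lifting to a statement about the original generators. -/
lemma isHeadAdditive_liftGenerators {n k : ℕ} {m : Fin (n + 1) → ℕ} (hk : 0 < k)
    (hcop : Nat.Coprime k (m 0))
    (h : ∀ d : Fin n → ℕ, ∀ u, ∑ i, d i * m i.succ = u + m 0 → HasFactorization m 0 u →
      ∃ c : Fin (n + 1) → ℕ, ∑ i, c i * m i = u ∧
        ∑ i, d i ≤ k * (c 0 + 1) + ∑ i : Fin n, c i.succ) :
    IsHeadAdditive (liftGenerators k m) := by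
  rintro l s ⟨a, ha, -⟩ ⟨d, hd, hl⟩
  by_cases h0 : d 0 = 0
  · rw [sum_mul_liftGenerators] at ha hd
    rw [h0, zero_mul, zero_add] at hd
    rw [Fin.sum_univ_succ, h0, zero_add] at hl
    simp only [liftGenerators, Fin.cons_zero] at hd
    -- Modulo `k`, only `(a 0 + 1) * m 0` survives in the two expressions for `s + m 0`.
    have hdvd : k ∣ a 0 + 1 := by
      refine hcop.dvd_of_dvd_mul_right ((Nat.dvd_add_left (dvd_mul_right k
        (∑ i : Fin n, a i.succ * m i.succ))).mp ?_)
      refine ⟨∑ i : Fin n, d i.succ * m i.succ, ?_⟩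
      rw [hd, ← ha]; ring
    obtain ⟨e, he⟩ := hdvd
    obtain ⟨e, rfl⟩ : ∃ e', e = e' + 1 :=
      Nat.exists_eq_succ_of_ne_zero (by rintro rfl; omega)
    have hu : ∑ i : Fin n, d i.succ * m i.succ =
        (e * m 0 + ∑ i : Fin n, a i.succ * m i.succ) + m 0 := by
      refine Nat.eq_of_mul_eq_mul_left hk ?_
      rw [hd, ← ha]
      linear_combination m 0 * he
    obtain ⟨c, hc, hlc⟩ := h (fun i ↦ d i.succ) _ hu
      ⟨Fin.cons e fun i ↦ a i.succ, by simp [Fin.sum_univ_succ], by simp⟩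
    rw [Fin.sum_univ_succ] at hc
    -- Here `s + m 0 = k * (u + m 0)`: each `k * m 0` splits into `k` copies of `m 0`, while each `k
    -- * m i` is a single generator.
    refine hasFactorization_of_head_pos (c := Fin.cons (k * (c 0 + 1)) fun i ↦ c i.succ)
      ?_ ?_ ?_
    · simp [hk.ne']
    · rw [sum_mul_liftGenerators]
      simp only [Fin.cons_zero, Fin.cons_succ, liftGenerators]
      rw [← hd, hu, ← hc]
      ring
    · simp only [Fin.sum_univ_succ, Fin.cons_zero, Fin.cons_succ]
      exact hl.trans hlc
  · exact hasFactorization_of_head_pos h0 hd hl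

/-- Head additivity gives `u` a factorization at most one shorter than `d`; the `+ 1` in `k * (c 0 +
1)` makes up for it. -/
lemma IsHeadAdditive.liftGenerators {n k : ℕ} {m : Fin (n + 1) → ℕ} (h : IsHeadAdditive m)
    (hm : 0 < m 0) (hk : 0 < k) (hcop : Nat.Coprime k (m 0)) : IsHeadAdditive (liftGenerators k m) := by
  refine isHeadAdditive_liftGenerators hk hcop fun d u hd hu ↦ ?_
  obtain ⟨c, hc, hl⟩ := h (∑ i, d i - 1) u hu
    ⟨Fin.cons 0 d, by simpa [Fin.sum_univ_succ] using hd, by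
      by_cases h0 : ∑ i, d i = 0
      · have hd0 : ∀ i, d i = 0 := by simpa using h0
        simp only [hd0, zero_mul, Finset.sum_const_zero] at hd
        omega
      · simp [Fin.sum_univ_succ]; omega⟩
  refine ⟨c, hc, ?_⟩
  rw [Fin.sum_univ_succ] at hl
  have := Nat.le_mul_of_pos_left (c 0 + 1) hk
  omega

lemma exists_forall_isHeadAdditive_liftGenerators {n : ℕ} (m : Fin (n + 1) → ℕ) :
    ∃ k₀ : ℕ, 0 < k₀ ∧ ∀ k : ℕ, k₀ ≤ k → Nat.Coprime k (m 0) →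
      IsHeadAdditive (liftGenerators k m) := by
  let B : Set (Fin n → ℕ) := {d | ∃ u, ∑ i, d i * m i.succ = u + m 0 ∧ HasFactorization m 0 u}
  -- Dickson's lemma: minimal elements form an antichain in the well-quasi-ordered `Fin n → ℕ`.
  have hfin : {d | Minimal (· ∈ B) d}.Finite :=
    WellQuasiOrderedLE.finite_of_isAntichain (setOfPred_minimal_antichain _)
  obtain ⟨b, hb⟩ := (hfin.image fun d ↦ ∑ i, d i).bddAbove
  refine ⟨b + 1, b.succ_pos, fun k hk hcop ↦
    isHeadAdditive_liftGenerators (by omega) hcop fun d u hd hu ↦ ?_⟩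
  obtain ⟨d', hle, hmin⟩ := exists_minimal_le_of_wellFoundedLT (· ∈ B) d ⟨u, hd, hu⟩
  obtain ⟨u', hd', a, ha, -⟩ := hmin.prop
  have hb' : ∑ i, d' i ≤ b := hb ⟨d', hmin, rfl⟩
  -- Add the excess `d - d'` to a factorization of `u'`: it contributes equally to both lengths, and
  -- `∑ d' ≤ b < k` covers the rest.
  refine ⟨Fin.cons (a 0) fun i ↦ a i.succ + (d i - d' i), ?_, ?_⟩
  · have h1 : ∑ i, d i * m i.succ = ∑ i, d' i * m i.succ + ∑ i, (d i - d' i) * m i.succ := by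
      rw [← Finset.sum_add_distrib]
      exact Finset.sum_congr rfl fun i _ ↦ by rw [← add_mul, Nat.add_sub_cancel' (hle i)]
    rw [Fin.sum_univ_succ] at ha
    simp only [Fin.sum_univ_succ, Fin.cons_zero, Fin.cons_succ, add_mul, Finset.sum_add_distrib]
    omega
  · have h1 : ∑ i, d i = ∑ i, d' i + ∑ i, (d i - d' i) := by
      rw [← Finset.sum_add_distrib]
      exact Finset.sum_congr rfl fun i _ ↦ by rw [Nat.add_sub_cancel' (hle i)]
    have := Nat.le_mul_of_pos_right k (Nat.succ_pos (a 0))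
    simp only [Fin.cons_zero, Fin.cons_succ, Finset.sum_add_distrib]
    simp only [Nat.succ_eq_add_one] at this
    omega

/-! ### Powers of the ideal of the origin -/

section OriginIdeal

open Polynomial

variable {K : Type*} [Field K] {ι : Type*} {m : ι → ℕ}

/-- The monomial `t ^ m i` as an element of the semigroup ring. -/
noncomputable def semigroupRing.gen (K : Type*) [Field K] {ι : Type*} (m : ι → ℕ) (i : ι) :
    semigroupRing K m :=
  ⟨X ^ m i, Algebra.subset_adjoin ⟨i, rfl⟩⟩

lemma gen_mem_originIdeal (i : ι) : semigroupRing.gen K m i ∈ originIdeal K m :=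
  Ideal.subset_span ⟨i, rfl⟩

instance [Finite ι] : IsNoetherianRing (semigroupRing K m) := by
  have h : (semigroupRing K m).FG := Subalgebra.fg_def.mpr ⟨_, Set.finite_range _, rfl⟩
  have := (semigroupRing K m).fg_iff_finiteType.mp h
  exact Algebra.FiniteType.isNoetherianRing K _

variable [Fintype ι]

lemma hasFactorization_of_coeff_mul_ne_zero {p q : K[X]} {j l : ℕ}
    (hp : ∀ s, p.coeff s ≠ 0 → HasFactorization m j s)
    (hq : ∀ s, q.coeff s ≠ 0 → HasFactorization m l s) (s : ℕ) (hs : (p * q).coeff s ≠ 0) :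
    HasFactorization m (j + l) s := by
  rw [coeff_mul] at hs
  obtain ⟨⟨a, b⟩, hab, hne⟩ := Finset.exists_ne_zero_of_sum_ne_zero hs
  rw [← Finset.HasAntidiagonal.mem_antidiagonal.mp hab]
  exact (hp a (left_ne_zero_of_mul hne)).add (hq b (right_ne_zero_of_mul hne))

lemma hasFactorization_of_coeff_X_pow_ne_zero (i : ι) (s : ℕ)
    (hs : (X ^ m i : K[X]).coeff s ≠ 0) : HasFactorization m 1 s := by
  rw [coeff_X_pow] at hs
  rw [(ite_ne_right_iff.mp hs).1]
  exact .single m i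

lemma hasFactorization_of_mem_semigroupRing (a : semigroupRing K m) (s : ℕ)
    (hs : (a : K[X]).coeff s ≠ 0) : HasFactorization m 0 s := by
  obtain ⟨a, ha⟩ := a
  simp only at hs
  induction ha using Algebra.adjoin_induction generalizing s with
  | mem x hx =>
    obtain ⟨i, rfl⟩ := hx
    exact (hasFactorization_of_coeff_X_pow_ne_zero i s hs).mono zero_le_one
  | algebraMap r =>
    rw [algebraMap_eq, coeff_C] at hs
    rw [(ite_ne_right_iff.mp hs).1]
    exact .zero m
  | add x y _ _ hx hy =>
    rw [coeff_add] at hs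
    by_cases h : x.coeff s = 0
    · exact hy s (by rwa [h, zero_add] at hs)
    · exact hx s h
  | mul x y _ _ hx hy => exact hasFactorization_of_coeff_mul_ne_zero hx hy s hs

lemma hasFactorization_of_mem_originIdeal {a : semigroupRing K m} (ha : a ∈ originIdeal K m)
    (s : ℕ) (hs : (a : K[X]).coeff s ≠ 0) : HasFactorization m 1 s := by
  induction ha using Submodule.span_induction generalizing s with
  | mem x hx =>
    obtain ⟨i, rfl⟩ := hx
    exact hasFactorization_of_coeff_X_pow_ne_zero i s hs
  | zero => simp at hs
  | add x y _ _ hx hy =>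
    rw [Subalgebra.coe_add, coeff_add] at hs
    by_cases h : (x : K[X]).coeff s = 0
    · exact hy s (by rwa [h, zero_add] at hs)
    · exact hx s h
  | smul r x _ hx =>
    have := hasFactorization_of_coeff_mul_ne_zero (hasFactorization_of_mem_semigroupRing r) hx s hs
    simpa using this

lemma exists_mem_originIdeal_pow_eq_X_pow {j s : ℕ} (h : HasFactorization m j s) :
    ∃ a ∈ originIdeal K m ^ j, (a : K[X]) = X ^ s := by
  obtain ⟨c, rfl, hj⟩ := h
  refine ⟨∏ i, semigroupRing.gen K m i ^ c i, Ideal.pow_le_pow_right hj ?_, ?_⟩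
  · rw [← Finset.prod_pow_eq_pow_sum]
    exact Ideal.prod_mem_prod fun i _ ↦ Ideal.pow_mem_pow (gen_mem_originIdeal i) _
  · rw [← Finset.prod_pow_eq_pow_sum, SubmonoidClass.coe_finsetProd]
    refine Finset.prod_congr rfl fun i _ ↦ ?_
    rw [mul_comm, pow_mul]
    rfl

lemma mem_originIdeal_pow {j : ℕ} {a : semigroupRing K m} : a ∈ originIdeal K m ^ j ↔
    ∀ s, (a : K[X]).coeff s ≠ 0 → HasFactorization m j s := by
  refine ⟨fun ha ↦ ?_, fun h ↦ ?_⟩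
  · induction j generalizing a with
    | zero => exact hasFactorization_of_mem_semigroupRing a
    | succ j ih =>
      rw [pow_succ] at ha
      induction ha using Submodule.mul_induction_on' with
      | mem_mul_mem x hx y hy =>
        exact hasFactorization_of_coeff_mul_ne_zero (ih hx)
          (hasFactorization_of_mem_originIdeal hy)
      | add x _ y _ hx hy =>
        intro s hs
        rw [Subalgebra.coe_add, coeff_add] at hs
        by_cases h : (x : K[X]).coeff s = 0
        · exact hy s (by rwa [h, zero_add] at hs)
        · exact hx s h
  · choose! b hb hbX using fun s hs ↦ exists_mem_originIdeal_pow_eq_X_pow (K := K) (h s hs)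
    have : a = ∑ s ∈ (a : K[X]).support, (a : K[X]).coeff s • b s := by
      refine Subtype.ext ?_
      rw [AddSubmonoidClass.coe_finsetSum]
      conv_lhs => rw [(a : K[X]).as_sum_support]
      refine Finset.sum_congr rfl fun s hs ↦ ?_
      rw [Subalgebra.coe_smul, hbX s (mem_support_iff.mp hs), smul_X_eq_monomial]
    rw [this]
    refine Ideal.sum_mem _ fun s hs ↦ ?_
    rw [Algebra.smul_def]
    exact Ideal.mul_mem_left _ _ (hb s (mem_support_iff.mp hs))

end OriginIdeal

/-! ### The associated graded ring as an algebra over a polynomial ring -/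

section AssocGraded

open Polynomial

lemma isSMulRegular_self_iff {G : Type*} [CommRing G] {x : G} :
    IsSMulRegular G x ↔ ∀ z, x * z = 0 → z = 0 :=
  isSMulRegular_iff_right_eq_zero_of_smul

/-- The subring of the elements congruent modulo the nilradical to an element of the range. -/
def RingHom.rangeModNilradical {R G : Type*} [CommRing R] [CommRing G] (φ : R →+* G) :
    Subring G :=
  ((Ideal.Quotient.mk (nilradical G)).comp φ).range.comap (Ideal.Quotient.mk (nilradical G))

lemma RingHom.mem_rangeModNilradical {R G : Type*} [CommRing R] [CommRing G] {φ : R →+* G}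
    {g : G} : g ∈ φ.rangeModNilradical ↔ ∃ f, IsNilpotent (g - φ f) := by
  refine exists_congr fun f ↦ ?_
  rw [eq_comm]
  exact Ideal.Quotient.mk_eq_mk_iff_sub_mem _ _

noncomputable instance {K A : Type*} [CommSemiring K] [CommRing A] [Algebra K A] (I : Ideal A) :
    Algebra K (reesAlgebra I) := (reesAlgebra I).algebra'

noncomputable instance {K A : Type*} [CommSemiring K] [CommRing A] [Algebra K A] (I : Ideal A) :
    Algebra K (AssocGradedRing I) := Ideal.Quotient.algebra K

variable {K A : Type*} [Field K] [CommRing A] [Algebra K A] {I : Ideal A} {t : A}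

/-- An element of `I`, placed in degree one of the Rees algebra. -/
noncomputable def reesGen (ht : t ∈ I) : reesAlgebra I :=
  ⟨monomial 1 t, reesAlgebra.monomial_mem.mpr (by simpa using ht)⟩

lemma coe_reesGen_pow (ht : t ∈ I) (j : ℕ) :
    ((reesGen ht ^ j : reesAlgebra I) : A[X]) = monomial j (t ^ j) := by
  rw [SubmonoidClass.coe_pow, reesGen, monomial_pow, one_mul]

/-- The initial form in degree one of an element of `I`. -/
noncomputable def initialForm (ht : t ∈ I) : AssocGradedRing I := Ideal.Quotient.mk _ (reesGen ht)

lemma mk_assocGraded_eq_zero {g : reesAlgebra I} :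
    Ideal.Quotient.mk (assocGradedIdeal I) g = 0 ↔ ∀ i, (g : A[X]).coeff i ∈ I ^ (i + 1) :=
  Ideal.Quotient.eq_zero_iff_mem

/-- Multiplication by a degree-one element shifts degrees, so regularity can be tested on
homogeneous elements. -/
lemma isSMulRegular_initialForm_iff (ht : t ∈ I) :
    IsSMulRegular (AssocGradedRing I) (initialForm ht) ↔
      ∀ j, ∀ a ∈ I ^ j, t * a ∈ I ^ (j + 2) → a ∈ I ^ (j + 1) := by
  refine (isSMulRegular_self_iff (G := AssocGradedRing I)).trans ?_
  have hmul : ∀ (g : reesAlgebra I) (i : ℕ),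
      ((reesGen ht * g : reesAlgebra I) : A[X]).coeff (i + 1) = t * (g : A[X]).coeff i :=
    fun g i ↦ coeff_monomial_mul (g : A[X]) 1 i t
  refine ⟨fun h j a ha ha' ↦ ?_, fun h g hg ↦ ?_⟩
  · have := h (Ideal.Quotient.mk _ ⟨monomial j a, reesAlgebra.monomial_mem.mpr ha⟩) ?_
    · simpa using mk_assocGraded_eq_zero.mp this j
    · rw [initialForm, ← map_mul, mk_assocGraded_eq_zero]
      intro i
      have hco : ((reesGen ht * ⟨monomial j a, reesAlgebra.monomial_mem.mpr ha⟩ :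
          reesAlgebra I) : A[X]) = monomial (1 + j) (t * a) := monomial_mul_monomial ..
      rw [hco, coeff_monomial]
      split_ifs with hi
      · rw [← hi]
        convert ha' using 2
        omega
      · exact Ideal.zero_mem _
  · obtain ⟨g, rfl⟩ := Ideal.Quotient.mk_surjective g
    rw [initialForm, ← map_mul, mk_assocGraded_eq_zero] at hg
    refine mk_assocGraded_eq_zero.mpr fun i ↦ h i _ (g.2 i) ?_
    rw [← hmul]
    exact hg (i + 1)

lemma mk_aeval_reesGen (ht : t ∈ I) (f : K[X]) :
    Ideal.Quotient.mk (assocGradedIdeal I) (aeval (reesGen ht) f) = aeval (initialForm ht) f := by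
  induction f using Polynomial.induction_on' with
  | add p q hp hq => rw [map_add, map_add, map_add, hp, hq]
  | monomial j a =>
    rw [aeval_monomial, aeval_monomial, map_mul, map_pow]
    rfl

lemma coeff_aeval_reesGen (ht : t ∈ I) (f : K[X]) (j : ℕ) :
    (aeval (reesGen ht) f : A[X]).coeff j = f.coeff j • t ^ j := by
  induction f using Polynomial.induction_on' with
  | add p q hp hq => rw [map_add, Subalgebra.coe_add, coeff_add, hp, hq, coeff_add, add_smul]
  | monomial i a =>
    rw [aeval_monomial, ← Algebra.smul_def]
    have : ((a • reesGen ht ^ i : reesAlgebra I) : A[X]) = a • monomial i (t ^ i) := by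
      rw [← coe_reesGen_pow ht]; rfl
    rw [this, coeff_smul, coeff_monomial, coeff_monomial]
    split_ifs with h
    · rw [h]
    · simp

lemma mem_of_smul_mem {c : K} (hc : c ≠ 0) {a : A} {J : Ideal A} (h : c • a ∈ J) : a ∈ J := by
  have := J.mul_mem_left (algebraMap K A c⁻¹) h
  rwa [← Algebra.smul_def, inv_smul_smul₀ hc] at this

/-- Write `f = X ^ r * q` with `q(0) ≠ 0`. In degree `j`, the product of `q` with `g` is `q(0)`
times the coefficient of `g`, plus terms in lower coefficients of `g`, which vanish by induction. -/
lemma isSMulRegular_aeval_initialForm (ht : t ∈ I)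
    (h : IsSMulRegular (AssocGradedRing I) (initialForm ht)) (f : K[X]) (hf : f ≠ 0) :
    IsSMulRegular (AssocGradedRing I) (aeval (initialForm ht) f) := by
  obtain ⟨q, hq, hq0⟩ := exists_eq_pow_rootMultiplicity_mul_and_not_dvd f hf 0
  rw [map_zero, sub_zero] at hq hq0
  rw [hq, map_mul, map_pow, aeval_X]
  refine (h.pow _).mul ?_
  rw [X_dvd_iff] at hq0
  refine (isSMulRegular_self_iff (G := AssocGradedRing I)).mpr fun g hg ↦ ?_
  obtain ⟨g, rfl⟩ := Ideal.Quotient.mk_surjective g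
  rw [← mk_aeval_reesGen, ← map_mul, mk_assocGraded_eq_zero] at hg
  refine mk_assocGraded_eq_zero.mpr fun j ↦ ?_
  induction j using Nat.strong_induction_on with
  | _ j ih =>
    have hj := hg j
    rw [MulMemClass.coe_mul, coeff_mul, Finset.Nat.sum_antidiagonal_eq_sum_range_succ
      (fun a b ↦ (aeval (reesGen ht) q : A[X]).coeff a * (g : A[X]).coeff b),
      Finset.sum_range_succ', Ideal.add_mem_iff_right, coeff_aeval_reesGen, pow_zero,
      Nat.sub_zero, smul_one_mul] at hj
    · exact mem_of_smul_mem hq0 hj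
    · refine Ideal.sum_mem _ fun a ha ↦ ?_
      have ha := Finset.mem_range.mp ha
      have h1 := Ideal.mul_mem_mul ((aeval (reesGen ht) q).2 (a + 1)) (ih (j - (a + 1)) (by omega))
      rw [← pow_add] at h1
      convert h1 using 2
      omega

lemma eq_zero_of_isNilpotent_aeval_initialForm (ht : t ∈ I) (hpow : ∀ j, t ^ j ∉ I ^ (j + 1))
    (f : K[X]) (hf : IsNilpotent (aeval (initialForm ht) f)) : f = 0 := by
  obtain ⟨N, hN⟩ := hf
  rw [← map_pow, ← mk_aeval_reesGen, mk_assocGraded_eq_zero] at hN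
  refine eq_zero_of_pow_eq_zero (n := N) ?_
  ext j
  rw [coeff_zero]
  by_contra hj
  have h := hN j
  rw [coeff_aeval_reesGen] at h
  exact hpow j (mem_of_smul_mem hj h)

lemma isNilpotent_initialForm (ht : t ∈ I) {N : ℕ} (hN : t ^ N ∈ I ^ (N + 1)) :
    IsNilpotent (initialForm ht) := by
  refine ⟨N, ?_⟩
  rw [initialForm, ← map_pow, mk_assocGraded_eq_zero]
  intro j
  rw [coe_reesGen_pow, coeff_monomial]
  split_ifs with hj
  · rwa [← hj]
  · exact Ideal.zero_mem _

/-- If `A = K + I` and every generator of `I` other than `t` has a nilpotent initial form, then the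
associated graded ring is generated by the initial form of `t` modulo nilpotents. -/
lemma exists_isNilpotent_sub_aeval_initialForm (ht : t ∈ I) {s : Set A} (hs : Ideal.span s = I)
    (hconst : ∀ a : A, ∃ c : K, a - algebraMap K A c ∈ I)
    (hnil : ∀ x ∈ s, x = t ∨ ∃ N, x ^ N ∈ I ^ (N + 1)) (g : AssocGradedRing I) :
    ∃ f : K[X], IsNilpotent (g - aeval (initialForm ht) f) := by
  let S := RingHom.rangeModNilradical (R := K[X]) (G := AssocGradedRing I)
    (aeval (initialForm ht) : K[X] →ₐ[K] AssocGradedRing I).toRingHom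
  have hS : ∀ g, g ∈ S ↔ ∃ f : K[X], IsNilpotent (g - aeval (initialForm ht) f) :=
    fun g ↦ RingHom.mem_rangeModNilradical
  have hdeg0 : ∀ a : A, Ideal.Quotient.mk (assocGradedIdeal I) (algebraMap A _ a) ∈ S := by
    intro a
    obtain ⟨c, hc⟩ := hconst a
    refine (hS _).mpr ⟨C c, ?_⟩
    have h0 : Ideal.Quotient.mk (assocGradedIdeal I) (algebraMap A _ a - algebraMap K _ c) = 0 →
        IsNilpotent (Ideal.Quotient.mk (assocGradedIdeal I) (algebraMap A _ a) -
          aeval (initialForm ht) (C c)) := by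
      intro h
      refine ⟨1, ?_⟩
      rw [pow_one, aeval_C]
      exact h
    refine h0 ?_
    refine mk_assocGraded_eq_zero.mpr fun j ↦ ?_
    have hco : ((algebraMap A (reesAlgebra I) a - algebraMap K (reesAlgebra I) c :
        reesAlgebra I) : A[X]) = C (a - algebraMap K A c) := by
      rw [C_sub]; rfl
    rw [hco, coeff_C]
    split_ifs with hj
    · rwa [hj, zero_add, pow_one]
    · exact Ideal.zero_mem _
  have hdeg1 : ∀ a (ha : a ∈ I), initialForm ha ∈ S := by
    intro a ha
    have ha' := ha
    rw [← hs] at ha'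
    induction ha' using Submodule.span_induction with
    | mem x hx =>
      rw [hS]
      rcases hnil x hx with rfl | ⟨N, hN⟩
      · exact ⟨X, 1, by rw [pow_one, aeval_X, sub_self]⟩
      · exact ⟨0, by rw [map_zero, sub_zero]; exact isNilpotent_initialForm ha hN⟩
    | zero =>
      convert S.zero_mem
      exact mk_assocGraded_eq_zero.mpr fun j ↦ by simp [reesGen]
    | add x y hx hy ihx ihy =>
      rw [← Ideal.span, hs] at hx hy
      convert S.add_mem (ihx hx) (ihy hy) using 1
      rw [initialForm, initialForm, initialForm, ← map_add]
      exact congrArg _ (Subtype.ext (map_add _ _ _))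
    | smul r x hx ih =>
      rw [← Ideal.span, hs] at hx
      convert S.mul_mem (hdeg0 r) (ih hx) using 1
      rw [initialForm, initialForm, ← map_mul]
      exact congrArg _ (Subtype.ext (C_mul_monomial ..).symm)
  obtain ⟨⟨g, hg⟩, rfl⟩ := Ideal.Quotient.mk_surjective g
  rw [← hS]
  have hg' := hg
  rw [← adjoin_monomial_eq_reesAlgebra] at hg'
  induction hg' using Algebra.adjoin_induction with
  | mem x hx =>
    obtain ⟨a, ha, rfl⟩ := hx
    exact hdeg1 a ha
  | algebraMap r => exact hdeg0 r
  | add x y hx hy ihx ihy =>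
    rw [adjoin_monomial_eq_reesAlgebra] at hx hy
    exact S.add_mem (ihx hx) (ihy hy)
  | mul x y hx hy ihx ihy =>
    rw [adjoin_monomial_eq_reesAlgebra] at hx hy
    exact S.mul_mem (ihx hx) (ihy hy)

/-- If the initial form of `t` generates the associated graded ring modulo nilpotents, then the
Cohen-Macaulay property amounts to this initial form being a nonzerodivisor. -/
theorem isCohenMacaulay_assocGradedRing_iff [IsNoetherianRing A] (ht : t ∈ I) {s : Set A}
    (hs : Ideal.span s = I) (hconst : ∀ a : A, ∃ c : K, a - algebraMap K A c ∈ I)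
    (hnil : ∀ x ∈ s, x = t ∨ ∃ N, x ^ N ∈ I ^ (N + 1)) (hpow : ∀ j, t ^ j ∉ I ^ (j + 1)) :
    IsCohenMacaulay (AssocGradedRing I) ↔
      ∀ j, ∀ a ∈ I ^ j, t * a ∈ I ^ (j + 2) → a ∈ I ^ (j + 1) := by
  rw [← isSMulRegular_initialForm_iff ht]
  have hgen := exists_isNilpotent_sub_aeval_initialForm ht hs hconst hnil
  refine ⟨fun h ↦ ?_, fun h ↦ ?_⟩
  · simpa using isSMulRegular_of_isCohenMacaulay _ hgen
      (eq_zero_of_isNilpotent_aeval_initialForm ht hpow) h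
  · exact isCohenMacaulay_of_isSMulRegular_aeval _ hgen (isSMulRegular_aeval_initialForm ht h)

end AssocGraded

/-! ### Cohen-Macaulay tangent cones of monomial curves -/

section TangentCone

open Polynomial

variable {n : ℕ} {m : Fin (n + 1) → ℕ}

lemma isHeadAdditive_iff_originIdeal (K : Type*) [Field K] : IsHeadAdditive m ↔
    ∀ j, ∀ a ∈ originIdeal K m ^ j, semigroupRing.gen K m 0 * a ∈ originIdeal K m ^ (j + 2) →
      a ∈ originIdeal K m ^ (j + 1) := by
  have hmul : ∀ (l : ℕ) (a : semigroupRing K m),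
      semigroupRing.gen K m 0 * a ∈ originIdeal K m ^ l ↔
      ∀ s, (a : K[X]).coeff s ≠ 0 → HasFactorization m l (s + m 0) := by
    intro l a
    rw [mem_originIdeal_pow]
    have hc : ((semigroupRing.gen K m 0 * a : semigroupRing K m) : K[X]) = X ^ m 0 * (a : K[X]) :=
      rfl
    rw [hc]
    refine ⟨fun h s hs ↦ h _ (by rwa [coeff_X_pow_mul]), fun h s hs ↦ ?_⟩
    rw [coeff_X_pow_mul'] at hs
    obtain ⟨hle, hs⟩ := ite_ne_right_iff.mp hs
    simpa [hle] using h _ hs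
  rw [isHeadAdditive_iff]
  refine ⟨fun h j a ha ha' ↦ ?_, fun h l s hs hs' ↦ ?_⟩
  · rw [mem_originIdeal_pow] at ha ⊢
    rw [hmul] at ha'
    exact fun s hs ↦ h j s (ha s hs) (ha' s hs)
  · obtain ⟨a, ha, haX⟩ := exists_mem_originIdeal_pow_eq_X_pow (K := K) hs
    refine mem_originIdeal_pow.mp (h l a ha ((hmul _ _).mpr fun s' hs'' ↦ ?_)) s (by simp [haX])
    rw [haX, coeff_X_pow] at hs''
    rwa [(ite_ne_right_iff.mp hs'').1]

lemma exists_sub_algebraMap_mem_originIdeal {K : Type*} [Field K] (a : semigroupRing K m) :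
    ∃ c : K, a - algebraMap K _ c ∈ originIdeal K m := by
  obtain ⟨a, ha⟩ := a
  induction ha using Algebra.adjoin_induction with
  | mem x hx =>
    obtain ⟨i, rfl⟩ := hx
    exact ⟨0, by rw [map_zero, sub_zero]; exact gen_mem_originIdeal i⟩
  | algebraMap c => exact ⟨c, by convert Ideal.zero_mem _; exact sub_self _⟩
  | add x y hx hy ihx ihy =>
    obtain ⟨c, hc⟩ := ihx
    obtain ⟨d, hd⟩ := ihy
    refine ⟨c + d, ?_⟩
    convert Ideal.add_mem _ hc hd using 1
    rw [map_add, sub_add_sub_comm]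
    rfl
  | mul x y hx hy ihx ihy =>
    obtain ⟨c, hc⟩ := ihx
    obtain ⟨d, hd⟩ := ihy
    refine ⟨c * d, ?_⟩
    have h := Ideal.add_mem _ (Ideal.mul_mem_right ⟨y, hy⟩ _ hc)
      (Ideal.mul_mem_left _ (algebraMap K _ c) hd)
    convert h using 1
    rw [map_mul, sub_mul, mul_sub, sub_add_sub_cancel]
    rfl

/-- The tangent cone of a monomial curve is Cohen-Macaulay if and only if adding `m 0` always
raises the maximal factorization length by exactly one. -/
theorem hasCohenMacaulayTangentCone_iff (K : Type*) [Field K] (hpos : 0 < m 0)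
    (hmult : ∀ i, m 0 ≤ m i) : HasCohenMacaulayTangentCone K m ↔ IsHeadAdditive m := by
  rw [isHeadAdditive_iff_originIdeal K, HasCohenMacaulayTangentCone]
  refine isCohenMacaulay_assocGradedRing_iff (K := K) (gen_mem_originIdeal 0) rfl
    exists_sub_algebraMap_mem_originIdeal ?_ ?_
  · rintro _ ⟨i, rfl⟩
    change semigroupRing.gen K m i = _ ∨ ∃ N, semigroupRing.gen K m i ^ N ∈ _
    rcases (hmult i).eq_or_lt with hi | hi
    · exact .inl (Subtype.ext (by simp only [semigroupRing.gen, hi]))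
    -- The power lies in `I ^ m i`, and `m i ≥ m 0 + 1`.
    · refine .inr ⟨m 0, ?_⟩
      have h : semigroupRing.gen K m i ^ m 0 = semigroupRing.gen K m 0 ^ m i := by
        refine Subtype.ext ?_
        simp only [semigroupRing.gen, SubmonoidClass.coe_pow, ← pow_mul, mul_comm]
      rw [h]
      exact Ideal.pow_le_pow_right hi (Ideal.pow_mem_pow (gen_mem_originIdeal 0) _)
  · intro j h
    -- A factorization of `m 0 * j` of length `j + 1` would have sum at least `(j + 1) * m 0`, since
    -- `m 0` is the least generator.
    have h1 := (mem_originIdeal_pow.mp h (m 0 * j)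
      (by simp [semigroupRing.gen, ← pow_mul])).mul_le hmult
    rw [add_mul, one_mul, mul_comm] at h1
    omega

end TangentCone

theorem theorem3p3 (K : Type*) [Field K] {n : ℕ} (m : Fin (n + 1) → ℕ)
    (hmin : IsMinimalGenerators m) (hmult : ∀ i, m 0 ≤ m i) :
    (HasCohenMacaulayTangentCone K m →
      ∀ k : ℕ, 0 < k → Nat.Coprime k (m 0) →
        HasCohenMacaulayTangentCone K (liftGenerators k m)) ∧
    (¬ HasCohenMacaulayTangentCone K m →
      ∃ k₀ : ℕ, 0 < k₀ ∧ ∀ k : ℕ, k₀ ≤ k → Nat.Coprime k (m 0) →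
        HasCohenMacaulayTangentCone K (liftGenerators k m)) := by
  have hlift : ∀ k, 0 < k → (HasCohenMacaulayTangentCone K (liftGenerators k m) ↔
      IsHeadAdditive (liftGenerators k m)) := by
    refine fun k hk ↦ hasCohenMacaulayTangentCone_iff K (hmin.1 0) fun i ↦ ?_
    refine Fin.cases le_rfl (fun i ↦ ?_) i
    exact (hmult i.succ).trans (Nat.le_mul_of_pos_left _ hk)
  refine ⟨fun h k hk hcop ↦ ?_, fun _ ↦ ?_⟩
  · rw [hasCohenMacaulayTangentCone_iff K (hmin.1 0) hmult] at h
    exact (hlift k hk).mpr (h.liftGenerators (hmin.1 0) hk hcop)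
  · obtain ⟨k₀, hk₀, h⟩ := exists_forall_isHeadAdditive_liftGenerators m
    exact ⟨k₀, hk₀, fun k hk hcop ↦ (hlift k (by omega)).mpr (h k hk hcop)⟩
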